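/- Fix a spin $S\in\{1/2,1,3/2,\dots\}$, a real number $D$ with $1\le D<2$, and positive constants $C_0$, $J^{XY}_{\max}$, $J^{Z}_{\max}$, $\Delta E$. There are constants $\gamma>0$ and $C>0$, depending only on these data, such that the following holds. Let $(\Lambda_k)_{k\ge 0}$, $\Lambda_k=(\Lambda_{k,s},\Lambda_{k,b})$ (sites and bonds), be a sequence of finite connected lattices (graphs) with $|\Lambda_{k,s}|\to\infty$. Let $\mathrm{dist}$ be the graph distance, and suppose that all spheres $S_r(m)=\{\ell\in\Lambda_{k,s}:\mathrm{dist}(\ell,m)=r\}$ satisfy $|S_r(m)|\le C_0 r^{D-1}$ for all $k$, $m\in\Lambda_{k,s}$ and $r\ge 1$. Consider on each $\Lambda=\Lambda_k$ the XXZ Heisenberg Hamiltonian $$H_\Lambda=2\sum_{\{i,j\}\in\Lambda_b}J^{XY}_{i,j}\,(S_i^xS_j^x+S_i^yS_j^y)+\sum_{\{i,j\}\in\Lambda_b}J^{Z}_{i,j}\,S_i^zS_j^z$$ with spin-$S$ operators and real couplings (which may depend on $k$), $|J^{XY}_{i,j}|\le J^{XY}_{\max}$ and $|J^{Z}_{i,j}|\le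 J^{Z}_{\max}$ for every bond. Let $H_{\Lambda,M}$ be the restriction of $H_\Lambda$ to the eigenspace of $S^z_\Lambda=\sum_i S^z_i$ with eigenvalue $M=M_k$. Suppose that there is a uniform gap $\Delta E$ above the sector of the ground state of $H_{\Lambda,M}$: for each $k$ there is a nonempty set $\mathcal E_k$ of eigenvalues at the bottom of the spectrum of $H_{\Lambda_k,M_k}$, such that every eigenvalue of $H_{\Lambda_k,M_k}$ outside $\mathcal E_k$ exceeds every element of $\mathcal E_k$ by more than $\Delta E$, and such that $\max_{E,E'\in\mathcal E_k}|E-E'|\to 0$ as $k\to\infty$. Let $P_{0,M}$ be the orthogonal projection onto the span of the eigenvectors of $H_{\Lambda,M}$ with eigenvalues in $\mathcal E_k$, let $q_M=\mathrm{Tr}\,P_{0,M}$ be its rank (which may depend on $k$), and put $\langle A\rangle_{0,M}=\frac1{q_M}\mathrm{Tr}\,(A\,P_{0,M})$ and $S_i^\pm=S_i^x\pm iS_i^y$. Then for every $R\in\mathbb N$, for all sufficiently large $k$ (depending on $R$ and on the sequence) and all sites $m,n\in\Lambda_{k,s}$ with $\mathrm{dist}(m,n)\le R$, $$\left|\langle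 S_m^+S_n^-\rangle_{0,M}\right|\le C\exp\left[-\gamma\,\{\mathrm{dist}(m,n)\}^{1-D/2}\right].$$ -/

import Mathlib

open Filter Topology

noncomputable section

namespace XXZ

/-! ### The spin operators of a single site

The spin is `S = s / 2` with `s : ℕ`; the index `a : Fin (s + 1)` labels the normalized eigenvector
of `S^z` with eigenvalue `s / 2 - a`. -/

/-- The eigenvalue of `S^z` that belongs to the basis vector `a`. -/
def mag (s : ℕ) (a : Fin (s + 1)) : ℝ := (s : ℝ) / 2 - (a : ℕ)

/-- The standard raising matrix: `S^+ |m⟩ = √(S (S + 1) - m (m + 1)) |m + 1⟩`. -/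
def raising (s : ℕ) : Matrix (Fin (s + 1)) (Fin (s + 1)) ℂ := fun a b =>
  if (b : ℕ) = a + 1 then
    ((Real.sqrt ((s : ℝ) / 2 * ((s : ℝ) / 2 + 1) - mag s b * (mag s b + 1)) : ℝ) : ℂ)
  else 0

/-- `S^x`. -/
def spinX (s : ℕ) : Matrix (Fin (s + 1)) (Fin (s + 1)) ℂ :=
  (1 / 2 : ℂ) • (raising s + (raising s).conjTranspose)

/-- `S^y`. -/
def spinY (s : ℕ) : Matrix (Fin (s + 1)) (Fin (s + 1)) ℂ :=
  (-(Complex.I / 2)) • (raising s - (raising s).conjTranspose)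

/-- `S^z`. -/
def spinZ (s : ℕ) : Matrix (Fin (s + 1)) (Fin (s + 1)) ℂ :=
  Matrix.diagonal fun a => (mag s a : ℂ)

/-- `S^+ = S^x + i S^y`. -/
def spinPlus (s : ℕ) : Matrix (Fin (s + 1)) (Fin (s + 1)) ℂ := spinX s + Complex.I • spinY s

/-- `S^- = S^x - i S^y`. -/
def spinMinus (s : ℕ) : Matrix (Fin (s + 1)) (Fin (s + 1)) ℂ := spinX s - Complex.I • spinY s

theorem spinZ_comm_raising (s : ℕ) :
    spinZ s * raising s - raising s * spinZ s = raising s := by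
  ext a b
  simp only [spinZ, Matrix.sub_apply, Matrix.diagonal_mul, Matrix.mul_diagonal, raising]
  split_ifs with h
  · simp only [mag, h]; push_cast; ring
  · simp

theorem spinZ_comm_lowering (s : ℕ) :
    spinZ s * (raising s).conjTranspose - (raising s).conjTranspose * spinZ s
      = -(raising s).conjTranspose := by
  ext a b
  simp only [spinZ, Matrix.sub_apply, Matrix.neg_apply, Matrix.diagonal_mul, Matrix.mul_diagonal,
    Matrix.conjTranspose_apply, raising]
  split_ifs with h
  · simp only [mag, h]; push_cast; ring
  · simp

theorem spinZ_comm_spinX (s : ℕ) :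
    spinZ s * spinX s - spinX s * spinZ s = Complex.I • spinY s := by
  have h1 := spinZ_comm_raising s
  have h2 := spinZ_comm_lowering s
  have : spinZ s * spinX s - spinX s * spinZ s
      = (1 / 2 : ℂ) • ((spinZ s * raising s - raising s * spinZ s)
        + (spinZ s * (raising s).conjTranspose - (raising s).conjTranspose * spinZ s)) := by
    simp only [spinX, Matrix.mul_smul, Matrix.smul_mul, mul_add, add_mul]
    module
  rw [this, h1, h2, spinY, smul_smul]
  have hI : Complex.I * -(Complex.I / 2) = 1 / 2 := by
    linear_combination (-1 / 2 : ℂ) * Complex.I_mul_I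
  rw [hI, sub_eq_add_neg]

theorem spinZ_comm_spinY (s : ℕ) :
    spinZ s * spinY s - spinY s * spinZ s = -(Complex.I • spinX s) := by
  have h1 := spinZ_comm_raising s
  have h2 := spinZ_comm_lowering s
  have : spinZ s * spinY s - spinY s * spinZ s
      = (-(Complex.I / 2)) • ((spinZ s * raising s - raising s * spinZ s)
        - (spinZ s * (raising s).conjTranspose - (raising s).conjTranspose * spinZ s)) := by
    simp only [spinY, Matrix.mul_smul, Matrix.smul_mul, mul_sub, sub_mul]
    module
  rw [this, h1, h2, spinX]
  module

/-! ### Operators on the space of spin states -/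

section Lattice

variable {V : Type*} [Fintype V] [DecidableEq V]

/-- Spin configurations; they label the product basis of `⨂_{i ∈ V} ℂ^(s+1)`. -/
abbrev Config (V : Type*) (s : ℕ) : Type _ := V → Fin (s + 1)

/-- The Hilbert space of the spin states, in coordinates with respect to the product basis. -/
abbrev State (V : Type*) (s : ℕ) : Type _ := EuclideanSpace ℂ (Config V s)

/-- Operators on the space of spin states, as matrices in the product basis. -/
abbrev Op (V : Type*) (s : ℕ) : Type _ := Matrix (Config V s) (Config V s) ℂ

/-- The one-site matrix `A` acting at the site `i` (and as the identity at all other sites). -/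
def site {s : ℕ} (i : V) (A : Matrix (Fin (s + 1)) (Fin (s + 1)) ℂ) : Op V s := fun σ τ =>
  if ∀ j, j ≠ i → σ j = τ j then A (σ i) (τ i) else 0

theorem site_mulVec {s : ℕ} (i : V) (A : Matrix (Fin (s + 1)) (Fin (s + 1)) ℂ)
    (ψ : Config V s → ℂ) (σ : Config V s) :
    (site i A).mulVec ψ σ = ∑ a, A (σ i) a * ψ (Function.update σ i a) := by
  classical
  simp only [Matrix.mulVec, dotProduct, site, ite_mul, zero_mul]
  rw [← Finset.sum_filter]
  symm
  refine Finset.sum_bij' (fun a _ => Function.update σ i a) (fun τ _ => τ i) ?_ ?_ ?_ ?_ ?_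
  · intro a _
    simp only [Finset.mem_filter, Finset.mem_univ, true_and]
    intro j hj
    rw [Function.update_of_ne hj]
  · intro τ _
    exact Finset.mem_univ _
  · intro a _
    simp
  · intro τ hτ
    simp only [Finset.mem_filter, Finset.mem_univ, true_and] at hτ
    funext j
    by_cases hj : j = i
    · subst hj; simp
    · rw [Function.update_of_ne hj, hτ j hj]
  · intro a _
    simp

theorem site_mul {s : ℕ} (i : V) (A B : Matrix (Fin (s + 1)) (Fin (s + 1)) ℂ) :
    site i A * site i B = site i (A * B) := by
  apply Matrix.mulVec_injective
  funext ψ σ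
  rw [← Matrix.mulVec_mulVec]
  simp only [site_mulVec, Function.update_idem, Function.update_self, Finset.mul_sum,
    Matrix.mul_apply, Finset.sum_mul]
  rw [Finset.sum_comm]
  simp only [mul_assoc]

theorem site_commute {s : ℕ} {i j : V} (hij : i ≠ j)
    (A B : Matrix (Fin (s + 1)) (Fin (s + 1)) ℂ) :
    site i A * site j B = site j B * site i A := by
  apply Matrix.mulVec_injective
  funext ψ σ
  rw [← Matrix.mulVec_mulVec, ← Matrix.mulVec_mulVec]
  simp only [site_mulVec, Finset.mul_sum, Function.update_of_ne hij, Function.update_of_ne hij.symm]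
  rw [Finset.sum_comm]
  refine Finset.sum_congr rfl fun a _ => Finset.sum_congr rfl fun b _ => ?_
  rw [Function.update_comm hij]
  ring

theorem site_mul_comm_self {s : ℕ} (i j : V) (A : Matrix (Fin (s + 1)) (Fin (s + 1)) ℂ) :
    site i A * site j A = site j A * site i A := by
  by_cases h : i = j
  · rw [h]
  · exact site_commute h A A

theorem site_sub {s : ℕ} (i : V) (A B : Matrix (Fin (s + 1)) (Fin (s + 1)) ℂ) :
    site i (A - B) = site i A - site i B := by
  ext σ τ
  simp only [site, Matrix.sub_apply]
  split_ifs <;> simp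

theorem site_smul {s : ℕ} (i : V) (c : ℂ) (A : Matrix (Fin (s + 1)) (Fin (s + 1)) ℂ) :
    site i (c • A) = c • site i A := by
  ext σ τ
  simp only [site, Matrix.smul_apply]
  split_ifs <;> simp

theorem site_neg {s : ℕ} (i : V) (A : Matrix (Fin (s + 1)) (Fin (s + 1)) ℂ) :
    site i (-A) = -site i A := by
  ext σ τ
  simp only [site, Matrix.neg_apply]
  split_ifs <;> simp

/-- The operator `2 J^XY (S_i^x S_j^x + S_i^y S_j^y) + J^Z S_i^z S_j^z` of the bond `{i, j}`. -/
def bondTerm (s : ℕ) (JXY JZ : Sym2 V → ℝ) (e : Sym2 V) : Op V s :=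
  ((2 * JXY e : ℝ) : ℂ) •
      Sym2.lift ⟨fun i j => site i (spinX s) * site j (spinX s) + site i (spinY s) * site j (spinY s),
        fun i j => by
          dsimp only
          rw [site_mul_comm_self i j (spinX s), site_mul_comm_self i j (spinY s)]⟩ e
    + ((JZ e : ℝ) : ℂ) •
      Sym2.lift ⟨fun i j => site i (spinZ s) * site j (spinZ s),
        fun i j => site_mul_comm_self i j (spinZ s)⟩ e

/-- The Hamiltonian of the XXZ Heisenberg model with spin `s / 2` on the lattice with site set `V`
whose bonds are the edges of `G`. -/
def hamiltonian (s : ℕ) (G : SimpleGraph V) [DecidableRel G.Adj] (JXY JZ : Sym2 V → ℝ) : Op V s :=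
  ∑ e ∈ G.edgeFinset, bondTerm s JXY JZ e

/-- The `z`-component of the total spin. -/
def totalSpinZ (V : Type*) [Fintype V] [DecidableEq V] (s : ℕ) : Op V s :=
  ∑ i : V, site i (spinZ s)

theorem totalSpinZ_mul_site {s : ℕ} (i : V) (A : Matrix (Fin (s + 1)) (Fin (s + 1)) ℂ) :
    totalSpinZ V s * site i A
      = site i A * totalSpinZ V s + site i (spinZ s * A - A * spinZ s) := by
  rw [site_sub, ← site_mul, ← site_mul, totalSpinZ, Finset.sum_mul, Finset.mul_sum,
    ← Finset.add_sum_erase _ _ (Finset.mem_univ i),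
    ← Finset.add_sum_erase (Finset.univ) (fun k => site i A * site k (spinZ s))
      (Finset.mem_univ i)]
  have : ∑ k ∈ Finset.univ.erase i, site k (spinZ s) * site i A
      = ∑ k ∈ Finset.univ.erase i, site i A * site k (spinZ s) :=
    Finset.sum_congr rfl fun k hk => site_commute (Finset.ne_of_mem_erase hk) _ _
  rw [this]
  abel

theorem totalSpinZ_commute_bondTerm (s : ℕ) (JXY JZ : Sym2 V → ℝ) (e : Sym2 V) :
    Commute (totalSpinZ V s) (bondTerm s JXY JZ e) := by
  induction e with | _ i j
  have hX : ∀ k : V, totalSpinZ V s * site k (spinX s)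
      = site k (spinX s) * totalSpinZ V s + Complex.I • site k (spinY s) := fun k => by
    rw [totalSpinZ_mul_site, spinZ_comm_spinX, site_smul]
  have hY : ∀ k : V, totalSpinZ V s * site k (spinY s)
      = site k (spinY s) * totalSpinZ V s - Complex.I • site k (spinX s) := fun k => by
    rw [totalSpinZ_mul_site, spinZ_comm_spinY, site_neg, site_smul, sub_eq_add_neg]
  have hZ : ∀ k : V, Commute (totalSpinZ V s) (site k (spinZ s)) := fun k => by
    have h0 : site k (0 : Matrix (Fin (s + 1)) (Fin (s + 1)) ℂ) = 0 := by
      ext σ τ; simp [site]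
    rw [Commute, SemiconjBy, totalSpinZ_mul_site, sub_self, h0, add_zero]
  simp only [bondTerm, Sym2.lift_mk]
  refine Commute.add_right (Commute.smul_right ?_ _)
    (Commute.smul_right ((hZ i).mul_right (hZ j)) _)
  rw [Commute, SemiconjBy, mul_add, ← mul_assoc, ← mul_assoc, hX, hY, add_mul, sub_mul,
    mul_assoc, mul_assoc (site i (spinY s)), hX, hY]
  simp only [mul_add, mul_sub, add_mul, mul_assoc, Matrix.mul_smul, Matrix.smul_mul]
  abel

theorem totalSpinZ_commute_hamiltonian (s : ℕ) (G : SimpleGraph V) [DecidableRel G.Adj]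
    (JXY JZ : Sym2 V → ℝ) : Commute (totalSpinZ V s) (hamiltonian s G JXY JZ) :=
  Commute.sum_right _ _ _ fun e _ => totalSpinZ_commute_bondTerm s JXY JZ e

/-! ### The sectors of fixed magnetization -/

/-- The eigenspace of the total `z`-spin with the eigenvalue `M`. -/
def sector (V : Type*) [Fintype V] [DecidableEq V] (s : ℕ) (M : ℝ) : Submodule ℂ (State V s) :=
  Module.End.eigenspace (Matrix.toEuclideanLin (totalSpinZ V s)) (M : ℂ)

theorem hamiltonian_mem_sector (s : ℕ) (G : SimpleGraph V) [DecidableRel G.Adj]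
    (JXY JZ : Sym2 V → ℝ) (M : ℝ) (ψ : State V s) (hψ : ψ ∈ sector V s M) :
    Matrix.toEuclideanLin (hamiltonian s G JXY JZ) ψ ∈ sector V s M := by
  rw [sector, Module.End.mem_eigenspace_iff] at hψ ⊢
  have h := (totalSpinZ_commute_hamiltonian s G JXY JZ).eq
  have h' := congrArg (fun A => Matrix.toEuclideanLin A ψ) h
  simp only [Matrix.toEuclideanLin, Matrix.toLpLin_mul_same, LinearMap.comp_apply] at h' hψ ⊢
  rw [h', hψ, map_smul]

/-- The restriction of the Hamiltonian to the sector with magnetization `M`. -/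
def sectorHamiltonian (s : ℕ) (G : SimpleGraph V) [DecidableRel G.Adj]
    (JXY JZ : Sym2 V → ℝ) (M : ℝ) : Module.End ℂ (sector V s M) :=
  (Matrix.toEuclideanLin (hamiltonian s G JXY JZ)).restrict
    (hamiltonian_mem_sector s G JXY JZ M)

/-- The (real) spectrum of the restricted Hamiltonian; since the restricted Hamiltonian is
hermitian, this is its whole spectrum. -/
def sectorSpectrum (s : ℕ) (G : SimpleGraph V) [DecidableRel G.Adj]
    (JXY JZ : Sym2 V → ℝ) (M : ℝ) : Set ℝ :=
  spectrum ℝ (sectorHamiltonian s G JXY JZ M)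

/-- The span of all eigenvectors of the restricted Hamiltonian whose eigenvalues lie in `E0`, as a
subspace of the whole space of spin states. -/
def groundSpace (s : ℕ) (G : SimpleGraph V) [DecidableRel G.Adj]
    (JXY JZ : Sym2 V → ℝ) (M : ℝ) (E0 : Set ℝ) : Submodule ℂ (State V s) :=
  (⨆ E ∈ E0, Module.End.eigenspace (sectorHamiltonian s G JXY JZ M) (E : ℂ)).map
    (sector V s M).subtype

/-- The expectation `(1 / q) Tr (A P)`, where `P` is the orthogonal projection onto the
ground-state sector and `q` is its degeneracy, i.e. the dimension of the range of `P`. -/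
def groundExpectation (s : ℕ) (G : SimpleGraph V) [DecidableRel G.Adj]
    (JXY JZ : Sym2 V → ℝ) (M : ℝ) (E0 : Set ℝ) (A : Op V s) : ℂ :=
  (1 / (Module.finrank ℂ (groundSpace s G JXY JZ M E0) : ℂ)) *
    LinearMap.trace ℂ (State V s)
      (Matrix.toEuclideanLin A ∘ₗ
        ((groundSpace s G JXY JZ M E0).starProjection : State V s →ₗ[ℂ] State V s))

end Lattice

/-! ### The lattices and the uniform gap -/

/-- A connected lattice all of whose spheres satisfy `|S_r(m)| ≤ C₀ r ^ (D - 1)` for `r ≥ 1`. -/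
structure HasDimension {V : Type*} (G : SimpleGraph V) (D C₀ : ℝ) : Prop where
  connected : G.Connected
  card_sphere_le : ∀ (m : V) (r : ℕ), 1 ≤ r →
    ({l : V | G.dist l m = r}.ncard : ℝ) ≤ C₀ * (r : ℝ) ^ (D - 1)

/-- `spec k` is the spectrum of the Hamiltonian on the `k`-th lattice of a sequence whose volume
tends to infinity and `E0 k` is the set of the eigenvalues of its ground-state sector. There is a
uniform gap `ΔE` above the ground-state sector: the sector is nonempty, it lies at the bottom of
the spectrum, its distance from the rest of the spectrum is larger than `ΔE`, and its width tends
to zero in the limit of infinite volume. -/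
structure HasUniformGap (spec E0 : ℕ → Set ℝ) (ΔE : ℝ) : Prop where
  nonempty : ∀ k, (E0 k).Nonempty
  subset : ∀ k, E0 k ⊆ spec k
  gap : ∀ k, ∀ E ∈ E0 k, ∀ E' ∈ spec k \ E0 k, E + ΔE < E'
  width : Tendsto (fun k => Metric.diam (E0 k)) atTop (𝓝 0)

end XXZ

end

/-! The proof combines a complex rotation about the z-axis with the spectral gap. Let `L = exp (∑ φ
i S_i^z)` with real `φ`; it is self-adjoint, invertible and commutes with the total `S^z`. For `X =
S_m^+ S_n^-` one has `L X L⁻¹ = exp (φ m - φ n) X`, so cyclicity gives `Tr (X P) = exp (-(φ m - φ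
n)) Tr ((L⁻¹ P L) X)`. The oblique projection `L⁻¹ P L` has rank at most `q`, so this trace is at
most `q ‖L⁻¹ P L‖ ‖X‖`, and `q` cancels in the expectation. It remains to bound `‖L⁻¹ P L‖` by an
absolute constant, although `‖L‖` itself may be huge.

The bound `2` (`norm_conj_starProjection_le`) holds once `L` and `L⁻¹` map the range `W` of `P`
close to `W`. This follows from the gap (`norm_apply_sub_starProjection_le`): for `ψ ∈ W` and `y = L
ψ`, the energy `⟨y, H y⟩` differs from `Re ⟨y, L H L⁻¹ y⟩ ≈ e ‖y‖²` by half the quadratic form of `L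
H L⁻¹ + L⁻¹ H L - 2 H`. There the first order in `φ` cancels: a bond contributes `cosh (φ i - φ j) -
1`. Hence `y` has little excess energy.

With `r = dist (m, n)`, let `φ` be a cone around `m` of radius `r` and slope `δ r ^ (-D / 2)`. It
touches `O(r ^ D)` bonds, so the second-order change is `O(δ²)` uniformly in `r`, while `φ m - φ n =
δ r ^ (1 - D / 2)`. The gap fixes a small `δ`. The width of the ground-state sector enters
multiplied by `1 + ‖L‖²`, which is bounded in terms of `R`; hence `k` must be large depending on
`R`. -/

noncomputable section

namespace XXZ

/-! ### Oblique projections close to an orthogonal projection -/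

section Abstract

variable {E : Type*} [NormedAddCommGroup E] [InnerProductSpace ℂ E]

/-- The trace of an operator with range in `U` and norm at most `c` is at most `dim U * c`. -/
theorem norm_trace_le_finrank_mul [FiniteDimensional ℂ E] (U : Submodule ℂ E)
    (T : E →ₗ[ℂ] E) (c : ℝ)
    (hU : ∀ x, T x ∈ U) (hc : ∀ x, ‖T x‖ ≤ c * ‖x‖) :
    ‖LinearMap.trace ℂ E T‖ ≤ Module.finrank ℂ U * c := by
  rw [← LinearMap.trace_restrict_eq_of_forall_mem U T hU,
    LinearMap.trace_eq_sum_inner _ (stdOrthonormalBasis ℂ U)]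
  refine (norm_sum_le _ _).trans ?_
  have h : ∀ i ∈ Finset.univ, ‖inner ℂ (stdOrthonormalBasis ℂ U i)
      (T.restrict (fun x _ => hU x) (stdOrthonormalBasis ℂ U i))‖ ≤ c := fun i _ => by
    refine (norm_inner_le_norm _ _).trans ?_
    rw [(stdOrthonormalBasis ℂ U).norm_eq_one, one_mul]
    refine (hc _).trans_eq ?_
    rw [Submodule.subtype_apply, ← Submodule.coe_norm, (stdOrthonormalBasis ℂ U).norm_eq_one,
      mul_one]
  refine (Finset.sum_le_card_nsmul _ _ _ h).trans_eq ?_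
  simp

/-- If the images of `W` under two mutually inverse operators `L`, `L'` are close to `W` and `L'` is
symmetric, then the oblique projection `L ∘ P ∘ L'`, where `P` is the orthogonal projection onto
`W`, is bounded by `2`. -/
theorem norm_conj_starProjection_le [FiniteDimensional ℂ E] (W : Submodule ℂ E)
    (L L' : E →ₗ[ℂ] E) (hLL' : ∀ x, L (L' x) = x) (hL'L : ∀ x, L' (L x) = x)
    (hL' : L'.IsSymmetric)
    (h : ∀ ψ ∈ W, ‖L ψ - W.starProjection (L ψ)‖ ^ 2 ≤ 1 / 4 * ‖L ψ‖ ^ 2)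
    (h' : ∀ ψ ∈ W, ‖L' ψ - W.starProjection (L' ψ)‖ ^ 2 ≤ 1 / 4 * ‖L' ψ‖ ^ 2) (x : E) :
    ‖L (W.starProjection (L' x))‖ ≤ 2 * ‖x‖ := by
  have pyth : ∀ v : E, ‖v‖ ^ 2 = ‖W.starProjection v‖ ^ 2 + ‖v - W.starProjection v‖ ^ 2 := by
    intro v
    have h0 : inner ℂ (W.starProjection v) (v - W.starProjection v) = 0 :=
      (W.sub_starProjection_mem_orthogonal v) _ (W.starProjection_apply_mem v)
    have := norm_add_sq_eq_norm_sq_add_norm_sq_of_inner_eq_zero _ _ h0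
    rw [add_sub_cancel] at this
    nlinarith
  set y := L (W.starProjection (L' x)) with hy
  -- Test vector: `z = L' ψ` with the same projection onto `W` as `y`. Then `⟨z, y⟩ = ⟨z, x⟩`, whose
  -- right side no longer contains `L`. The vector exists because the compression of `L'` to `W` is
  -- injective: by `h'`, `L' ψ` cannot be orthogonal to `W` unless it vanishes.
  obtain ⟨ψ, hψ⟩ : ∃ ψ : W, W.starProjection (L' ψ) = W.starProjection y := by
    let f : W →ₗ[ℂ] W := W.orthogonalProjectionOnto.toLinearMap ∘ₗ L' ∘ₗ W.subtype
    have hf : Function.Surjective f := by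
      rw [← LinearMap.injective_iff_surjective, injective_iff_map_eq_zero]
      intro ψ hψ
      have h0 : W.starProjection (L' ψ) = 0 := congrArg (Subtype.val) hψ
      have h1 := h' ψ ψ.2
      rw [h0, sub_zero] at h1
      have h2 : L' ψ = 0 := by
        rw [← norm_eq_zero]; nlinarith [norm_nonneg (L' (ψ : E))]
      have h3 := hLL' ψ
      rw [h2, map_zero] at h3
      exact Subtype.ext h3.symm
    obtain ⟨ψ, hψ⟩ := hf (W.orthogonalProjectionOnto y)
    exact ⟨ψ, congrArg Subtype.val hψ⟩
  set z := L' (ψ : E) with hz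
  have hzx : inner ℂ z y = inner ℂ z x := by
    rw [hz, hy, hL', hL'L, ← W.inner_starProjection_left_eq_right,
      W.starProjection_eq_self_iff.mpr ψ.2, ← hL']
  have hzy : inner ℂ z y = inner ℂ (W.starProjection y) (W.starProjection y)
      + inner ℂ (z - W.starProjection z) (y - W.starProjection y) := by
    rw [inner_sub_left, inner_sub_right, inner_sub_right, hψ,
      W.inner_starProjection_left_eq_right, W.inner_starProjection_left_eq_right,
      W.starProjection_eq_self_iff.mpr (W.starProjection_apply_mem y),
      ← W.inner_starProjection_left_eq_right z y, hψ,
      W.inner_starProjection_left_eq_right]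
    ring
  have h1 := h' ψ ψ.2
  rw [← hz, hψ] at h1
  have h2 := h _ (W.starProjection_apply_mem (L' x))
  rw [← hy] at h2
  have h3 := pyth y
  have h4 := pyth z
  rw [hψ] at h4
  have h5 : ‖W.starProjection y‖ ^ 2 ≤ ‖z‖ * ‖x‖
      + ‖z - W.starProjection y‖ * ‖y - W.starProjection y‖ := by
    have e : ((‖W.starProjection y‖ ^ 2 : ℝ) : ℂ)
        = inner ℂ z x - inner ℂ (z - W.starProjection y) (y - W.starProjection y) := by
      rw [hψ] at hzy
      rw [← hzx, hzy, inner_self_eq_norm_sq_to_K]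
      simp
    have := congrArg norm e
    rw [Complex.norm_real, Real.norm_of_nonneg (by positivity)] at this
    rw [this]
    refine (norm_sub_le _ _).trans ?_
    gcongr <;> exact norm_inner_le_norm _ _
  set p := ‖W.starProjection y‖
  set a := ‖z - W.starProjection y‖
  set b := ‖y - W.starProjection y‖
  have hp : 0 ≤ p := norm_nonneg _
  have ha : 0 ≤ a := norm_nonneg _
  have hb : 0 ≤ b := norm_nonneg _
  -- By Pythagoras the factor `1 / 4` in the hypotheses gives `a ^ 2, b ^ 2 ≤ p ^ 2 / 3`. This leads
  -- to `p ^ 2 ≤ 3 ‖x‖ ^ 2`, and `‖y‖ ^ 2 ≤ 4 / 3 * p ^ 2` then yields the constant `2`.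
  have h6 : a * b ≤ p ^ 2 / 3 := by nlinarith [sq_nonneg (a - b)]
  have h7 : 2 / 3 * p ^ 2 ≤ ‖z‖ * ‖x‖ := by linarith
  have h8 : ‖z‖ ^ 2 ≤ 4 / 3 * p ^ 2 := by linarith
  have h9 : (2 / 3 * p ^ 2) ^ 2 ≤ 4 / 3 * p ^ 2 * ‖x‖ ^ 2 :=
    calc (2 / 3 * p ^ 2) ^ 2 ≤ (‖z‖ * ‖x‖) ^ 2 := by gcongr
      _ = ‖z‖ ^ 2 * ‖x‖ ^ 2 := by ring
      _ ≤ _ := by gcongr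
  have h10 : p ^ 2 ≤ 3 * ‖x‖ ^ 2 := by
    rcases eq_or_ne p 0 with h0 | h0
    · rw [h0]; simp
    · have : 0 < p ^ 2 := by positivity
      nlinarith
  refine abs_le_of_sq_le_sq' ?_ (by positivity) |>.2
  nlinarith

/-! ### The spectral gap in terms of quadratic forms -/

variable {T : E →ₗ[ℂ] E} {S : Set ℝ} {e w Δ : ℝ}

theorem mem_orthogonal_iSup_eigenspace (hT : T.IsSymmetric) {v : E} {μ : ℝ} (hμ : μ ∉ S)
    (hv : T v = (μ : ℂ) • v) : v ∈ (⨆ E ∈ S, Module.End.eigenspace T (E : ℂ))ᗮ := by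
  rw [Submodule.mem_orthogonal]
  intro u hu
  induction hu using Submodule.iSup_induction' with
  | mem r u hu =>
    induction hu using Submodule.iSup_induction' with
    | mem hr u hu =>
      rw [Module.End.mem_eigenspace_iff] at hu
      have h := hT u v
      rw [hu, hv, inner_smul_left, inner_smul_right, Complex.conj_ofReal] at h
      have hne : (r : ℂ) - μ ≠ 0 := by
        rw [sub_ne_zero]; exact fun h0 => hμ (Complex.ofReal_injective h0 ▸ hr)
      have h0 : ((r : ℂ) - μ) * inner ℂ u v = 0 := by linear_combination h
      exact (mul_eq_zero.mp h0).resolve_left hne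
    | zero => simp
    | add x y _ _ hx hy => rw [inner_add_left, hx, hy, add_zero]
  | zero => simp
  | add x y _ _ hx hy => rw [inner_add_left, hx, hy, add_zero]

theorem inner_eigenvectorBasis_apply [FiniteDimensional ℂ E] (hT : T.IsSymmetric)
    {n : ℕ} (hn : Module.finrank ℂ E = n)
    (i : Fin n) (y : E) :
    inner ℂ (hT.eigenvectorBasis hn i) (T y)
      = (hT.eigenvalues hn i : ℂ) * inner ℂ (hT.eigenvectorBasis hn i) y := by
  rw [← hT, hT.apply_eigenvectorBasis hn, inner_smul_left]
  simp

/-- Compare coefficients in an eigenbasis: eigenvalues in `S` lose at most `w` against `e`, the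
others gain at least `Δ`, and only the latter contribute to the component orthogonal to the span of
the former. Small excess energy thus forces closeness to that span. -/
theorem gap_le_inner [FiniteDimensional ℂ E] (hT : T.IsSymmetric)
    (hgap : ∀ μ ∈ spectrum ℝ T \ S, e + Δ < μ)
    (hw : ∀ μ ∈ S, |μ - e| ≤ w) (hw0 : 0 ≤ w) (y : E) :
    Δ * ‖y - (⨆ E ∈ S, Module.End.eigenspace T (E : ℂ)).starProjection y‖ ^ 2 - w * ‖y‖ ^ 2
      ≤ (inner ℂ y (T y)).re - e * ‖y‖ ^ 2 := by
  set W := ⨆ E ∈ S, Module.End.eigenspace T (E : ℂ) with hW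
  set b := hT.eigenvectorBasis rfl
  rw [← b.sum_sq_norm_inner_right y, ← b.sum_sq_norm_inner_right (y - W.starProjection y),
    ← b.sum_inner_mul_inner, Complex.re_sum, Finset.mul_sum, Finset.mul_sum, Finset.mul_sum,
    ← Finset.sum_sub_distrib, ← Finset.sum_sub_distrib]
  refine Finset.sum_le_sum fun i _ => ?_
  have h1 : (inner ℂ y (b i) * inner ℂ (b i) (T y)).re
      = hT.eigenvalues rfl i * ‖inner ℂ (b i) y‖ ^ 2 := by
    rw [inner_eigenvectorBasis_apply hT rfl, ← inner_conj_symm, mul_left_comm,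
      Complex.re_ofReal_mul, mul_comm (starRingEnd ℂ _), Complex.mul_conj, Complex.ofReal_re,
      Complex.normSq_eq_norm_sq]
  rw [h1]
  have hb : T (b i) = (hT.eigenvalues rfl i : ℂ) • b i := hT.apply_eigenvectorBasis rfl i
  by_cases hi : hT.eigenvalues rfl i ∈ S
  · have hbW : b i ∈ W := by
      refine Submodule.mem_iSup_of_mem _ (Submodule.mem_iSup_of_mem hi ?_)
      exact Module.End.mem_eigenspace_iff.mpr hb
    rw [(W.sub_starProjection_mem_orthogonal y) _ hbW, norm_zero]
    have := (abs_le.mp (hw _ hi)).1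
    nlinarith [sq_nonneg ‖inner ℂ (b i) y‖]
  · have hbW := mem_orthogonal_iSup_eigenspace hT hi hb
    rw [inner_sub_right, (Submodule.mem_orthogonal' _ _).mp hbW _ (W.starProjection_apply_mem y),
      sub_zero]
    have hs : hT.eigenvalues rfl i ∈ spectrum ℝ T := by
      rw [← spectrum.algebraMap_mem_iff ℂ]
      exact (hT.hasEigenvalue_eigenvalues rfl i).mem_spectrum
    have := hgap _ ⟨hs, hi⟩
    nlinarith [sq_nonneg ‖inner ℂ (b i) y‖, mul_nonneg hw0 (sq_nonneg ‖inner ℂ (b i) y‖)]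

theorem norm_apply_sub_smul_le [FiniteDimensional ℂ E] (hT : T.IsSymmetric)
    (hw : ∀ μ ∈ S, |μ - e| ≤ w) (hw0 : 0 ≤ w)
    {y : E} (hy : y ∈ ⨆ E ∈ S, Module.End.eigenspace T (E : ℂ)) :
    ‖T y - (e : ℂ) • y‖ ≤ w * ‖y‖ := by
  set b := hT.eigenvectorBasis rfl
  refine abs_le_of_sq_le_sq' ?_ (by positivity) |>.2
  rw [mul_pow, ← b.sum_sq_norm_inner_right, ← b.sum_sq_norm_inner_right, Finset.mul_sum]
  refine Finset.sum_le_sum fun i _ => ?_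
  rw [inner_sub_right, inner_eigenvectorBasis_apply hT rfl, inner_smul_right, ← sub_mul,
    norm_mul, mul_pow]
  by_cases hi : hT.eigenvalues rfl i ∈ S
  · gcongr
    rw [← Complex.ofReal_sub, Complex.norm_real]
    exact hw _ hi
  · have hb : T (b i) = (hT.eigenvalues rfl i : ℂ) • b i := hT.apply_eigenvectorBasis rfl i
    rw [(Submodule.mem_orthogonal' _ _).mp (mem_orthogonal_iSup_eigenspace hT hi hb) _ hy]
    simp

/-- This transfers the gap, which is known only inside the magnetization sector, to the projection
in the whole space. -/
theorem starProjection_map_subtype_coe [FiniteDimensional ℂ E] (F : Submodule ℂ E)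
    (U : Submodule ℂ F) (y : F) :
    (U.map F.subtype).starProjection (y : E) = (U.starProjection y : F) := by
  refine Submodule.eq_starProjection_of_mem_of_inner_eq_zero
    (Submodule.mem_map_of_mem (U.starProjection_apply_mem y)) ?_
  rintro _ ⟨u, hu, rfl⟩
  exact (Submodule.mem_orthogonal' _ _).mp (U.sub_starProjection_mem_orthogonal y) u hu

theorem gap_le_inner_of_mem [FiniteDimensional ℂ E] (hT : T.IsSymmetric) {F : Submodule ℂ E}
    (hF : ∀ x ∈ F, T x ∈ F) (hgap : ∀ μ ∈ spectrum ℝ (T.restrict hF) \ S, e + Δ < μ)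
    (hw : ∀ μ ∈ S, |μ - e| ≤ w) (hw0 : 0 ≤ w) {y : E} (hy : y ∈ F) :
    Δ * ‖y - ((⨆ E ∈ S, Module.End.eigenspace (T.restrict hF) (E : ℂ)).map
        F.subtype).starProjection y‖ ^ 2 - w * ‖y‖ ^ 2 ≤ (inner ℂ y (T y)).re - e * ‖y‖ ^ 2 := by
  have h := gap_le_inner (hT.restrict_invariant hF) hgap hw hw0 ⟨y, hy⟩
  have hP := starProjection_map_subtype_coe F
    (⨆ E ∈ S, Module.End.eigenspace (T.restrict hF) (E : ℂ)) ⟨y, hy⟩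
  rw [hP]
  exact h

theorem norm_apply_sub_smul_le_of_mem [FiniteDimensional ℂ E] (hT : T.IsSymmetric)
    {F : Submodule ℂ E} (hF : ∀ x ∈ F, T x ∈ F) (hw : ∀ μ ∈ S, |μ - e| ≤ w) (hw0 : 0 ≤ w) {y : E}
    (hy : y ∈ (⨆ E ∈ S, Module.End.eigenspace (T.restrict hF) (E : ℂ)).map F.subtype) :
    ‖T y - (e : ℂ) • y‖ ≤ w * ‖y‖ := by
  obtain ⟨u, hu, rfl⟩ := hy
  exact norm_apply_sub_smul_le (hT.restrict_invariant hF) hw hw0 hu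

theorem finite_real_spectrum {U : Type*} [AddCommGroup U] [Module ℂ U] [FiniteDimensional ℂ U]
    (f : Module.End ℂ U) : (spectrum ℝ f).Finite := by
  refine Set.Finite.of_finite_image (f := ((↑) : ℝ → ℂ))
    ((Module.End.finite_spectrum f).subset ?_) Complex.ofReal_injective.injOn
  rintro _ ⟨μ, hμ, rfl⟩
  exact spectrum.algebraMap_mem_iff ℂ |>.mpr hμ

/-! ### Similarity transformations that change an operator by little -/

variable {L L' : E →ₗ[ℂ] E}

/-- If the even part of the change of `T` under the similarity transformation `L` is small in
comparison with the gap of `T` above `W`, then `L` maps `W` close to itself. -/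
theorem norm_apply_sub_starProjection_le [FiniteDimensional ℂ E] {W : Submodule ℂ E} {β ℓ : ℝ}
    {ψ : E} (hT : T.IsSymmetric) (hL : L.IsSymmetric) (hL' : L'.IsSymmetric)
    (hL'L : ∀ x, L' (L x) = x) (hΔ : 0 < Δ) (hw0 : 0 ≤ w)
    (hgap : Δ * ‖L ψ - W.starProjection (L ψ)‖ ^ 2 - w * ‖L ψ‖ ^ 2
      ≤ (inner ℂ (L ψ) (T (L ψ))).re - e * ‖L ψ‖ ^ 2)
    (hψ : ‖T ψ - (e : ℂ) • ψ‖ ≤ w * ‖ψ‖)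
    (hβ : ∀ y, ‖L (T (L' y)) + L' (T (L y)) - (2 : ℂ) • T y‖ ≤ 2 * β * ‖y‖)
    (hℓ0 : 0 ≤ ℓ) (hℓ : ∀ x, ‖L x‖ ≤ ℓ * ‖x‖) (hℓ' : ∀ x, ‖L' x‖ ≤ ℓ * ‖x‖)
    (hsmall : β + w * (1 + ℓ ^ 2) ≤ Δ / 4) :
    ‖L ψ - W.starProjection (L ψ)‖ ^ 2 ≤ 1 / 4 * ‖L ψ‖ ^ 2 := by
  set y := L ψ with hy
  have hL'y : L' y = ψ := hL'L ψ
  have h3 : |(inner ℂ y (L (T (L' y)) + L' (T (L y)) - (2 : ℂ) • T y)).re|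
      ≤ 2 * β * ‖y‖ ^ 2 := by
    refine (Complex.abs_re_le_norm _).trans ((norm_inner_le_norm _ _).trans ?_)
    nlinarith [norm_nonneg y, hβ y]
  -- The two conjugates of `T` are adjoint to each other, so their forms have the same real part;
  -- this removes the antihermitian first-order change.
  have h4 : (inner ℂ y (L' (T (L y)))).re = (inner ℂ y (L (T (L' y)))).re := by
    rw [← hL' y, ← hT (L' y), ← hL, ← inner_conj_symm, Complex.conj_re]
  rw [inner_sub_right, inner_add_right, inner_smul_right, Complex.sub_re, Complex.add_re, h4,
    hL'y, show (2 : ℂ) = ((2 : ℝ) : ℂ) by norm_cast, Complex.re_ofReal_mul] at h3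
  -- `T ψ` is `e ψ` up to an error of size `w`; applying `L` and writing `ψ = L' y` cost one factor
  -- `ℓ` each.
  have h5 : L (T ψ) = L (T ψ - (e : ℂ) • ψ) + (e : ℂ) • y := by
    rw [map_sub, map_smul, ← hy, sub_add_cancel]
  have hψy : ‖ψ‖ ≤ ℓ * ‖y‖ := hL'y ▸ hℓ' y
  have h6 : ‖L (T ψ - (e : ℂ) • ψ)‖ ≤ ℓ * (w * (ℓ * ‖y‖)) := by
    refine (hℓ _).trans ?_
    gcongr
    exact hψ.trans (by gcongr)
  have h7 : (inner ℂ y (L (T ψ))).re ≤ w * ℓ ^ 2 * ‖y‖ ^ 2 + e * ‖y‖ ^ 2 := by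
    have h8 : (inner ℂ y y).re = ‖y‖ ^ 2 := inner_self_eq_norm_sq (𝕜 := ℂ) y
    rw [h5, inner_add_right, inner_smul_right, Complex.add_re, Complex.re_ofReal_mul, h8]
    have h9 := (Complex.re_le_norm _).trans
      (norm_inner_le_norm (𝕜 := ℂ) y (L (T ψ - (e : ℂ) • ψ)))
    have h10 := mul_le_mul_of_nonneg_left h6 (norm_nonneg y)
    linarith
  have h11 := abs_le.mp h3
  have h12 := mul_le_mul_of_nonneg_right hsmall (sq_nonneg ‖y‖)
  have h13 : Δ * ‖y - W.starProjection y‖ ^ 2 ≤ Δ * (1 / 4 * ‖y‖ ^ 2) := by linarith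
  exact le_of_mul_le_mul_left h13 hΔ

/-- If `X = c • L X L⁻¹` and `L` and `L⁻¹` map `W` close to itself, then the trace of `X` over `W`
is bounded by `2 * |c| * ‖X‖ * dim W`. -/
theorem norm_trace_comp_starProjection_le [FiniteDimensional ℂ E] {W : Submodule ℂ E}
    {X : E →ₗ[ℂ] E} {c : ℂ} {K : ℝ} (hL : L.IsSymmetric) (hLL' : ∀ x, L (L' x) = x)
    (hL'L : ∀ x, L' (L x) = x) (hX : ∀ x, X x = c • L (X (L' x))) (hK : ∀ x, ‖X x‖ ≤ K * ‖x‖)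
    (h : ∀ ψ ∈ W, ‖L ψ - W.starProjection (L ψ)‖ ^ 2 ≤ 1 / 4 * ‖L ψ‖ ^ 2)
    (h' : ∀ ψ ∈ W, ‖L' ψ - W.starProjection (L' ψ)‖ ^ 2 ≤ 1 / 4 * ‖L' ψ‖ ^ 2) (hK0 : 0 ≤ K) :
    ‖LinearMap.trace ℂ E (X ∘ₗ (W.starProjection : E →ₗ[ℂ] E))‖
      ≤ ‖c‖ * (Module.finrank ℂ W * (2 * K)) := by
  set P : E →ₗ[ℂ] E := (W.starProjection : E →ₗ[ℂ] E)
  have h1 : X ∘ₗ P = c • ((L ∘ₗ X) ∘ₗ (L' ∘ₗ P)) := by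
    ext x
    exact hX (P x)
  -- Cyclicity gathers the unbounded factors into `L' P L`, whose range is `L' W` and whose norm is
  -- at most `2`.
  have h2 : LinearMap.trace ℂ E ((L ∘ₗ X) ∘ₗ (L' ∘ₗ P))
      = LinearMap.trace ℂ E ((L' ∘ₗ P ∘ₗ L) ∘ₗ X) := LinearMap.trace_comp_comm' _ _
  rw [h1, map_smul, smul_eq_mul, norm_mul, h2]
  refine mul_le_mul_of_nonneg_left ?_ (norm_nonneg c)
  refine (norm_trace_le_finrank_mul (W.map L') _ (2 * K)
    (fun x => ⟨_, W.starProjection_apply_mem (L (X x)), rfl⟩) fun x => ?_).trans ?_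
  · refine (norm_conj_starProjection_le W L' L hL'L hLL' hL h' h (X x)).trans ?_
    linarith [hK x]
  · gcongr
    exact Submodule.finrank_map_le L' W

end Abstract

/-! ### Complex rotations about the `z`-axis -/

section Gauge

open scoped Matrix.Norms.L2Operator

variable {V : Type*} [Fintype V] {s : ℕ}

/-- The exponent `∑ i, φ i * S_i^z` of the rotation by the imaginary angles `φ`. -/
def gaugeExponent (φ : V → ℝ) (σ : Config V s) : ℝ := ∑ j, φ j * mag s (σ j)

/-- The rotation `exp (∑ i, φ i * S_i^z)` by the imaginary angles `φ`. -/
def gaugeOp (s : ℕ) (φ : V → ℝ) : Op V s :=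
  Matrix.diagonal fun σ => ((Real.exp (gaugeExponent φ σ) : ℝ) : ℂ)

theorem gaugeExponent_neg (φ : V → ℝ) (σ : Config V s) :
    gaugeExponent (-φ) σ = -gaugeExponent φ σ := by
  simp [gaugeExponent]

theorem isHermitian_gaugeOp (φ : V → ℝ) : (gaugeOp s φ).IsHermitian := by
  rw [gaugeOp, Matrix.IsHermitian, Matrix.diagonal_conjTranspose]
  congr 1
  funext σ
  exact Complex.conj_ofReal _

theorem gaugeExponent_sub (φ : V → ℝ) {i : V} {σ τ : Config V s} (h : ∀ j, j ≠ i → σ j = τ j) :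
    gaugeExponent φ σ - gaugeExponent φ τ = φ i * (mag s (σ i) - mag s (τ i)) := by
  rw [gaugeExponent, gaugeExponent, ← Finset.sum_sub_distrib, Finset.sum_eq_single i]
  · ring
  · intro j _ hj
    rw [h j hj, sub_self]
  · simp

variable [DecidableEq V]

theorem site_add (i : V) (A B : Matrix (Fin (s + 1)) (Fin (s + 1)) ℂ) :
    site i (A + B) = site i A + site i B := by
  ext σ τ
  simp only [site, Matrix.add_apply]
  split_ifs <;> simp

theorem site_conjTranspose (i : V) (A : Matrix (Fin (s + 1)) (Fin (s + 1)) ℂ) :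
    site i A.conjTranspose = (site i A).conjTranspose := by
  ext σ τ
  simp only [site, Matrix.conjTranspose_apply]
  by_cases h : ∀ j, j ≠ i → σ j = τ j
  · rw [if_pos h, if_pos fun j hj => (h j hj).symm]
  · rw [if_neg h, if_neg fun h' => h fun j hj => (h' j hj).symm, star_zero]

/-- One-site matrices as operators, as a homomorphism of C⋆-algebras. -/
def siteHom (i : V) : Matrix (Fin (s + 1)) (Fin (s + 1)) ℂ →⋆ₙₐ[ℂ] Op V s where
  toFun := site i
  map_smul' c A := site_smul i c A
  map_zero' := by simpa using site_smul i 0 (0 : Matrix (Fin (s + 1)) (Fin (s + 1)) ℂ)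
  map_add' A B := site_add i A B
  map_mul' A B := (site_mul i A B).symm
  map_star' A := site_conjTranspose i A

/-- A star homomorphism of C⋆-algebras is contractive. -/
theorem norm_site_le (i : V) (A : Matrix (Fin (s + 1)) (Fin (s + 1)) ℂ) : ‖site i A‖ ≤ ‖A‖ :=
  NonUnitalStarAlgHom.norm_apply_le (siteHom i) A

theorem norm_site_mul_site_le (i j : V) (A B : Matrix (Fin (s + 1)) (Fin (s + 1)) ℂ) :
    ‖site i A * site j B‖ ≤ ‖A‖ * ‖B‖ :=
  (norm_mul_le _ _).trans (mul_le_mul (norm_site_le i A) (norm_site_le j B) (norm_nonneg _)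
    (norm_nonneg _))

theorem gaugeOp_mul_gaugeOp_neg (φ : V → ℝ) : gaugeOp s φ * gaugeOp s (-φ) = 1 := by
  rw [gaugeOp, gaugeOp, Matrix.diagonal_mul_diagonal, ← Matrix.diagonal_one]
  congr 1
  funext σ
  rw [gaugeExponent_neg, ← Complex.ofReal_mul, ← Real.exp_add, add_neg_cancel, Real.exp_zero,
    Complex.ofReal_one]

/-- Every nonzero matrix element of `site i A` changes the magnetization at `i` by `c` and nothing
elsewhere, so commuting it past the diagonal rotation costs one scalar. -/
theorem gaugeOp_mul_site {A : Matrix (Fin (s + 1)) (Fin (s + 1)) ℂ} {c : ℝ}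
    (hA : ∀ a b, A a b ≠ 0 → mag s a - mag s b = c) (φ : V → ℝ) (i : V) :
    gaugeOp s φ * site i A = (Real.exp (c * φ i) : ℂ) • (site i A * gaugeOp s φ) := by
  ext σ τ
  rw [Matrix.smul_apply, gaugeOp, Matrix.diagonal_mul, Matrix.mul_diagonal, site]
  split_ifs with h
  · by_cases h0 : A (σ i) (τ i) = 0
    · simp [h0]
    · have h1 := gaugeExponent_sub φ h
      rw [hA _ _ h0, sub_eq_iff_eq_add] at h1
      rw [h1, Real.exp_add, mul_comm (φ i)]
      push_cast
      rw [smul_eq_mul]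
      ring
  · simp

theorem gaugeOp_mul_site_raising (φ : V → ℝ) (i : V) :
    gaugeOp s φ * site i (raising s)
      = (Real.exp (φ i) : ℂ) • (site i (raising s) * gaugeOp s φ) := by
  have := gaugeOp_mul_site (A := raising s) (c := 1) (fun a b h => ?_) φ i
  · rwa [one_mul] at this
  · have hb : (b : ℕ) = a + 1 := by
      by_contra hne
      exact h (if_neg hne)
    simp only [mag, hb]
    push_cast
    ring

theorem gaugeOp_mul_site_lowering (φ : V → ℝ) (i : V) :
    gaugeOp s φ * site i (raising s).conjTranspose
      = (Real.exp (-φ i) : ℂ) • (site i (raising s).conjTranspose * gaugeOp s φ) := by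
  have := gaugeOp_mul_site (A := (raising s).conjTranspose) (c := -1) (fun a b h => ?_) φ i
  · rwa [neg_one_mul] at this
  · have hb : (a : ℕ) = b + 1 := by
      by_contra hne
      exact h (by rw [Matrix.conjTranspose_apply, raising, if_neg hne, star_zero])
    simp only [mag, hb]
    push_cast
    ring

theorem gaugeOp_mul_site_spinZ (φ : V → ℝ) (i : V) :
    gaugeOp s φ * site i (spinZ s) = site i (spinZ s) * gaugeOp s φ := by
  have := gaugeOp_mul_site (A := spinZ s) (c := 0) (fun a b h => ?_) φ i
  · simpa using this
  · have hb : a = b := by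
      by_contra hne
      exact h (Matrix.diagonal_apply_ne _ hne)
    rw [hb, sub_self]

theorem gaugeOp_commute_totalSpinZ (φ : V → ℝ) : Commute (gaugeOp s φ) (totalSpinZ V s) :=
  Commute.sum_right _ _ _ fun i _ => gaugeOp_mul_site_spinZ φ i

/-! ### Ladder form of the Hamiltonian and its change under rotations -/

theorem spinPlus_eq_raising : spinPlus s = raising s := by
  have h : Complex.I * -(Complex.I / 2) = 1 / 2 := by
    linear_combination (-1 / 2 : ℂ) * Complex.I_mul_I
  rw [spinPlus, spinX, spinY, smul_smul, h]
  module

theorem spinMinus_eq_lowering : spinMinus s = (raising s).conjTranspose := by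
  have h : Complex.I * -(Complex.I / 2) = 1 / 2 := by
    linear_combination (-1 / 2 : ℂ) * Complex.I_mul_I
  rw [spinMinus, spinX, spinY, smul_smul, h]
  module

/-- Conjugating `S_i^+ S_j^-` by a rotation multiplies it by `exp (φ i - φ j)`. -/
theorem gaugeOp_conj_raising_lowering (φ : V → ℝ) (i j : V) :
    gaugeOp s φ * (site i (raising s) * site j (raising s).conjTranspose) * gaugeOp s (-φ)
      = (Real.exp (φ i - φ j) : ℂ) • (site i (raising s) * site j (raising s).conjTranspose) := by
  rw [← mul_assoc, gaugeOp_mul_site_raising, Matrix.smul_mul, mul_assoc (site i _),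
    gaugeOp_mul_site_lowering, Matrix.mul_smul, smul_smul, Matrix.smul_mul, ← mul_assoc, mul_assoc,
    gaugeOp_mul_gaugeOp_neg, mul_one, sub_eq_add_neg, Real.exp_add, Complex.ofReal_mul]

theorem gaugeOp_conj_lowering_raising (φ : V → ℝ) (i j : V) :
    gaugeOp s φ * (site i (raising s).conjTranspose * site j (raising s)) * gaugeOp s (-φ)
      = (Real.exp (-(φ i - φ j)) : ℂ) •
        (site i (raising s).conjTranspose * site j (raising s)) := by
  rw [← mul_assoc, gaugeOp_mul_site_lowering, Matrix.smul_mul, mul_assoc (site i _),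
    gaugeOp_mul_site_raising, Matrix.mul_smul, smul_smul, Matrix.smul_mul, ← mul_assoc, mul_assoc,
    gaugeOp_mul_gaugeOp_neg, mul_one, neg_sub, sub_eq_neg_add, Real.exp_add, Complex.ofReal_mul]

theorem gaugeOp_conj_spinZ_spinZ (φ : V → ℝ) (i j : V) :
    gaugeOp s φ * (site i (spinZ s) * site j (spinZ s)) * gaugeOp s (-φ)
      = site i (spinZ s) * site j (spinZ s) := by
  rw [← mul_assoc, gaugeOp_mul_site_spinZ, mul_assoc (site i _), gaugeOp_mul_site_spinZ,
    ← mul_assoc, mul_assoc, gaugeOp_mul_gaugeOp_neg, mul_one]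

/-- Each summand in ladder form is an eigenvector of conjugation by `gaugeOp`. -/
theorem bondTerm_mk (JXY JZ : Sym2 V → ℝ) (i j : V) :
    bondTerm s JXY JZ s(i, j)
      = (JXY s(i, j) : ℂ) • (site i (raising s) * site j (raising s).conjTranspose
          + site i (raising s).conjTranspose * site j (raising s))
        + (JZ s(i, j) : ℂ) • (site i (spinZ s) * site j (spinZ s)) := by
  rw [bondTerm, Sym2.lift_mk, Sym2.lift_mk]
  congr 1
  have hI : -(Complex.I / 2) * -(Complex.I / 2) = -1 / 4 := by
    linear_combination (1 / 4 : ℂ) * Complex.I_mul_I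
  simp only [spinX, spinY, site_smul, site_add, site_sub, smul_mul_smul_comm, hI, add_mul, mul_add,
    sub_mul, mul_sub, Complex.ofReal_mul, Complex.ofReal_ofNat]
  module

theorem isHermitian_bondTerm (JXY JZ : Sym2 V → ℝ) (e : Sym2 V) :
    (bondTerm s JXY JZ e).IsHermitian := by
  induction e with | _ i j
  rw [bondTerm_mk, Matrix.IsHermitian]
  have hZ : (spinZ s).conjTranspose = spinZ s := by
    rw [spinZ, Matrix.diagonal_conjTranspose]
    congr 1
    funext a
    exact Complex.conj_ofReal _
  simp only [Matrix.conjTranspose_add, Matrix.conjTranspose_smul, Matrix.conjTranspose_mul,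
    ← site_conjTranspose, Matrix.conjTranspose_conjTranspose, hZ, Complex.star_def,
    Complex.conj_ofReal]
  rw [site_mul_comm_self j i (spinZ s)]
  congr 2
  -- For `i ≠ j` the adjoint exchanges the two hopping terms; on a loop each of them is its own
  -- adjoint.
  by_cases hij : i = j
  · subst hij; rfl
  · rw [site_commute (Ne.symm hij), site_commute (Ne.symm hij), add_comm]

theorem isHermitian_hamiltonian (G : SimpleGraph V) [DecidableRel G.Adj] (JXY JZ : Sym2 V → ℝ) :
    (hamiltonian s G JXY JZ).IsHermitian := by
  rw [Matrix.IsHermitian, hamiltonian, Matrix.conjTranspose_sum]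
  exact Finset.sum_congr rfl fun e _ => isHermitian_bondTerm JXY JZ e

/-- The even part of the change of `A` under the rotation by the imaginary angles `φ`. -/
def gaugeDefect (φ : V → ℝ) (A : Op V s) : Op V s :=
  gaugeOp s φ * A * gaugeOp s (-φ) + gaugeOp s (-φ) * A * gaugeOp s φ - (2 : ℂ) • A

/-- Both hopping terms acquire `exp x + exp (-x) - 2 = 2 (cosh x - 1)` with `x = φ i - φ j`, while
the `S^z S^z` part is invariant. -/
theorem gaugeDefect_bondTerm (φ : V → ℝ) (JXY JZ : Sym2 V → ℝ) (i j : V) :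
    gaugeDefect φ (bondTerm s JXY JZ s(i, j))
      = ((2 * JXY s(i, j) * (Real.cosh (φ i - φ j) - 1) : ℝ) : ℂ) •
        (site i (raising s) * site j (raising s).conjTranspose
          + site i (raising s).conjTranspose * site j (raising s)) := by
  have h1 := gaugeOp_conj_raising_lowering (s := s) (-φ) i j
  have h2 := gaugeOp_conj_lowering_raising (s := s) (-φ) i j
  have h3 := gaugeOp_conj_spinZ_spinZ (s := s) (-φ) i j
  rw [neg_neg] at h1 h2 h3
  simp only [gaugeDefect, bondTerm_mk, mul_add, add_mul, Matrix.mul_smul, Matrix.smul_mul, h1, h2,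
    h3, gaugeOp_conj_raising_lowering, gaugeOp_conj_lowering_raising, gaugeOp_conj_spinZ_spinZ,
    Real.cosh_eq, Pi.neg_apply]
  rw [show -φ i - -φ j = -(φ i - φ j) by ring, neg_neg]
  push_cast
  module

theorem cosh_sub_one_le_sq {x : ℝ} (hx : |x| ≤ 1) : Real.cosh x - 1 ≤ x ^ 2 := by
  have h0 : |x ^ 2 / 2| ≤ 1 := by
    rw [abs_of_nonneg (by positivity), ← sq_abs]
    nlinarith [abs_nonneg x]
  have h1 := (le_abs_self _).trans (Real.abs_exp_sub_one_le h0)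
  rw [abs_of_nonneg (by positivity)] at h1
  linarith [Real.cosh_le_exp_half_sq x]

theorem norm_gaugeDefect_bondTerm_le (φ : V → ℝ) (JXY JZ : Sym2 V → ℝ) {i j : V} {J g : ℝ}
    (hJ : |JXY s(i, j)| ≤ J) (hφ : |φ i - φ j| ≤ g) (hg : g ≤ 1) :
    ‖gaugeDefect φ (bondTerm s JXY JZ s(i, j))‖ ≤ 4 * J * ‖raising s‖ ^ 2 * g ^ 2 := by
  have h1 : ‖site i (raising s) * site j (raising s).conjTranspose
      + site i (raising s).conjTranspose * site j (raising s)‖ ≤ 2 * ‖raising s‖ ^ 2 := by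
    refine (norm_add_le _ _).trans ?_
    have h2 := norm_site_mul_site_le i j (raising s) (raising s).conjTranspose
    have h3 := norm_site_mul_site_le i j (raising s).conjTranspose (raising s)
    rw [Matrix.l2_opNorm_conjTranspose] at h2 h3
    linarith
  have h4 : 0 ≤ Real.cosh (φ i - φ j) - 1 := by linarith [Real.one_le_cosh (φ i - φ j)]
  have h5 : Real.cosh (φ i - φ j) - 1 ≤ g ^ 2 :=
    (cosh_sub_one_le_sq (hφ.trans hg)).trans (by rw [← sq_abs]; gcongr)
  have hJ0 : 0 ≤ J := (abs_nonneg _).trans hJ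
  rw [gaugeDefect_bondTerm, norm_smul, Complex.norm_real, norm_mul, norm_mul,
    Real.norm_of_nonneg h4]
  calc ‖(2 : ℝ)‖ * ‖JXY s(i, j)‖ * (Real.cosh (φ i - φ j) - 1) * _
      ≤ 2 * J * g ^ 2 * (2 * ‖raising s‖ ^ 2) := by
        gcongr
        · simp
        · exact hJ
    _ = _ := by ring

theorem gaugeDefect_hamiltonian (φ : V → ℝ) (G : SimpleGraph V) [DecidableRel G.Adj]
    (JXY JZ : Sym2 V → ℝ) : gaugeDefect φ (hamiltonian s G JXY JZ)
      = ∑ e ∈ G.edgeFinset, gaugeDefect φ (bondTerm s JXY JZ e) := by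
  simp only [gaugeDefect, hamiltonian, Finset.mul_sum, Finset.sum_mul, Finset.smul_sum,
    Finset.sum_add_distrib, Finset.sum_sub_distrib]

/-- A rotation with angles that vanish outside `B` and vary by at most `g` along every bond changes
the Hamiltonian to second order only, up to an antihermitian part. -/
theorem norm_gaugeDefect_hamiltonian_le (φ : V → ℝ) (G : SimpleGraph V) [DecidableRel G.Adj]
    (JXY JZ : Sym2 V → ℝ) {J g d : ℝ} (B : Finset V) (hJ : ∀ e ∈ G.edgeSet, |JXY e| ≤ J)
    (hB : ∀ i ∉ B, φ i = 0) (hφ : ∀ i j, G.Adj i j → |φ i - φ j| ≤ g) (hg : g ≤ 1)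
    (hJ0 : 0 ≤ J) (hd : ∀ i, (G.degree i : ℝ) ≤ d) :
    ‖gaugeDefect φ (hamiltonian s G JXY JZ)‖
      ≤ B.card * d * (4 * J * ‖raising s‖ ^ 2 * g ^ 2) := by
  rw [gaugeDefect_hamiltonian]
  set K := 4 * J * ‖raising s‖ ^ 2 * g ^ 2
  have hK : 0 ≤ K := by positivity
  -- Only bonds that meet `B` contribute, and the sum of the degrees over `B` bounds their number.
  have hsub : B.biUnion (fun i => G.incidenceFinset i) ⊆ G.edgeFinset := by
    intro e he
    obtain ⟨i, -, hi⟩ := Finset.mem_biUnion.mp he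
    exact G.incidenceFinset_subset i hi
  rw [← Finset.sum_subset hsub]
  · refine (norm_sum_le _ _).trans ((Finset.sum_le_card_nsmul _ _ K fun e he => ?_).trans ?_)
    · have he' := hsub he
      induction e with | _ i j
      rw [SimpleGraph.mem_edgeFinset] at he'
      exact norm_gaugeDefect_bondTerm_le φ JXY JZ (hJ _ he') (hφ i j he') hg
    · rw [nsmul_eq_mul]
      refine mul_le_mul_of_nonneg_right ?_ hK
      have h1 : ((B.biUnion fun i => G.incidenceFinset i).card : ℝ)
          ≤ ∑ i ∈ B, (G.degree i : ℝ) := by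
        have := Finset.card_biUnion_le (s := B) (t := fun i => G.incidenceFinset i)
        simp only [SimpleGraph.card_incidenceFinset_eq_degree] at this
        exact_mod_cast this
      refine h1.trans ((Finset.sum_le_card_nsmul _ _ d fun i _ => hd i).trans_eq ?_)
      rw [nsmul_eq_mul]
  · intro e he hne
    induction e with | _ i j
    have hadj : G.Adj i j := by simpa using he
    have hi : i ∉ B := fun hi => hne (Finset.mem_biUnion.mpr ⟨i, hi, by simpa using hadj⟩)
    have hj : j ∉ B := fun hj => hne (Finset.mem_biUnion.mpr ⟨j, hj, by
      simpa [SimpleGraph.mem_incidenceFinset, SimpleGraph.incidenceSet] using hadj⟩)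
    rw [gaugeDefect_bondTerm, hB i hi, hB j hj]
    simp

end Gauge

/-! ### Rotated ground states -/

section Rotated

open scoped Matrix.Norms.L2Operator

variable {V : Type*} [Fintype V] [DecidableEq V] {s : ℕ}

theorem norm_toEuclideanLin_le {ι : Type*} [Fintype ι] [DecidableEq ι] (A : Matrix ι ι ℂ)
    (x : EuclideanSpace ℂ ι) : ‖Matrix.toEuclideanLin A x‖ ≤ ‖A‖ * ‖x‖ :=
  Matrix.l2_opNorm_mulVec A x

theorem toEuclideanLin_mul_apply {ι : Type*} [Fintype ι] [DecidableEq ι] (A B : Matrix ι ι ℂ)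
    (x : EuclideanSpace ℂ ι) : Matrix.toEuclideanLin (A * B) x
      = Matrix.toEuclideanLin A (Matrix.toEuclideanLin B x) := by
  simp only [Matrix.toEuclideanLin, Matrix.toLpLin_mul_same, LinearMap.comp_apply]

theorem isSymmetric_gaugeOp (φ : V → ℝ) :
    (Matrix.toEuclideanLin (gaugeOp s φ)).IsSymmetric :=
  Matrix.isSymmetric_toEuclideanLin_iff.mpr (isHermitian_gaugeOp φ)

theorem gaugeOp_apply_gaugeOp_neg (φ : V → ℝ) (x : State V s) :
    Matrix.toEuclideanLin (gaugeOp s φ) (Matrix.toEuclideanLin (gaugeOp s (-φ)) x) = x := by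
  rw [← toEuclideanLin_mul_apply, gaugeOp_mul_gaugeOp_neg, Matrix.toEuclideanLin,
    Matrix.toLpLin_one, LinearMap.id_apply]

theorem gaugeOp_neg_apply_gaugeOp (φ : V → ℝ) (x : State V s) :
    Matrix.toEuclideanLin (gaugeOp s (-φ)) (Matrix.toEuclideanLin (gaugeOp s φ) x) = x := by
  simpa using gaugeOp_apply_gaugeOp_neg (-φ) x

/-- Evenness lets one smallness condition serve both `L` and `L⁻¹`. -/
theorem gaugeDefect_neg (φ : V → ℝ) (A : Op V s) : gaugeDefect (-φ) A = gaugeDefect φ A := by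
  rw [gaugeDefect, gaugeDefect, neg_neg, add_comm (_ * A * _)]

theorem gaugeOp_mem_sector (φ : V → ℝ) {M : ℝ} {ψ : State V s} (hψ : ψ ∈ sector V s M) :
    Matrix.toEuclideanLin (gaugeOp s φ) ψ ∈ sector V s M := by
  rw [sector, Module.End.mem_eigenspace_iff] at hψ ⊢
  rw [← toEuclideanLin_mul_apply, ← (gaugeOp_commute_totalSpinZ φ).eq, toEuclideanLin_mul_apply,
    hψ, map_smul]

theorem norm_gaugeOp_le (φ : V → ℝ) (B : Finset V) {a : ℝ} (ha : 0 ≤ a) (hB : ∀ i ∉ B, φ i = 0)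
    (hφ : ∀ i, |φ i| ≤ a) : ‖gaugeOp s φ‖ ≤ Real.exp (B.card * (a * s)) := by
  rw [gaugeOp, Matrix.l2_opNorm_diagonal, pi_norm_le_iff_of_nonneg (by positivity)]
  intro σ
  rw [Complex.norm_real, Real.norm_of_nonneg (by positivity), Real.exp_le_exp, gaugeExponent,
    ← Finset.sum_subset (Finset.subset_univ B) fun i _ hi => by rw [hB i hi, zero_mul]]
  refine (Finset.sum_le_card_nsmul _ _ (a * s) fun i _ => ?_).trans_eq (nsmul_eq_mul _ _)
  -- The sharp bound is `s / 2`; any bound independent of the lattice suffices.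
  have hmag : |mag s (σ i)| ≤ s := by
    have h1 : ((σ i : ℕ) : ℝ) ≤ s := by exact_mod_cast Nat.lt_succ_iff.mp (σ i).2
    have h2 : (0 : ℝ) ≤ ((σ i : ℕ) : ℝ) := by positivity
    rw [mag, abs_le]
    constructor <;> linarith
  refine (le_abs_self _).trans ?_
  rw [abs_mul]
  exact mul_le_mul (hφ i) hmag (abs_nonneg _) ha

variable {G : SimpleGraph V} [DecidableRel G.Adj] {JXY JZ : Sym2 V → ℝ} {M : ℝ} {E0 : Set ℝ}

theorem isSymmetric_hamiltonian :
    (Matrix.toEuclideanLin (hamiltonian s G JXY JZ)).IsSymmetric :=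
  Matrix.isSymmetric_toEuclideanLin_iff.mpr (isHermitian_hamiltonian G JXY JZ)

theorem finite_sectorSpectrum : (sectorSpectrum s G JXY JZ M).Finite :=
  finite_real_spectrum _

/-- A rotation that changes the Hamiltonian by little maps the ground-state sector close to
itself. -/
theorem norm_gaugeOp_sub_starProjection_le (φ : V → ℝ) {e w Δ β ℓ : ℝ} (hw0 : 0 ≤ w) (hΔ : 0 < Δ)
    (hgap : ∀ μ ∈ sectorSpectrum s G JXY JZ M \ E0, e + Δ < μ) (hw : ∀ μ ∈ E0, |μ - e| ≤ w)
    (hβ : ‖gaugeDefect φ (hamiltonian s G JXY JZ)‖ ≤ 2 * β) (hℓ : ‖gaugeOp s φ‖ ≤ ℓ)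
    (hℓ' : ‖gaugeOp s (-φ)‖ ≤ ℓ) (hsmall : β + w * (1 + ℓ ^ 2) ≤ Δ / 4) {ψ : State V s}
    (hψ : ψ ∈ groundSpace s G JXY JZ M E0) :
    ‖Matrix.toEuclideanLin (gaugeOp s φ) ψ - (groundSpace s G JXY JZ M E0).starProjection
        (Matrix.toEuclideanLin (gaugeOp s φ) ψ)‖ ^ 2
      ≤ 1 / 4 * ‖Matrix.toEuclideanLin (gaugeOp s φ) ψ‖ ^ 2 := by
  have hψF : ψ ∈ sector V s M := by
    obtain ⟨u, -, rfl⟩ := hψ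
    exact u.2
  have h1 := gap_le_inner_of_mem isSymmetric_hamiltonian (hamiltonian_mem_sector s G JXY JZ M)
    hgap hw hw0 (gaugeOp_mem_sector φ hψF)
  have h2 := norm_apply_sub_smul_le_of_mem isSymmetric_hamiltonian
    (hamiltonian_mem_sector s G JXY JZ M) hw hw0 hψ
  refine norm_apply_sub_starProjection_le isSymmetric_hamiltonian (isSymmetric_gaugeOp φ)
    (isSymmetric_gaugeOp (-φ)) (gaugeOp_neg_apply_gaugeOp φ) hΔ hw0 h1 h2 (fun y => ?_)
    ((norm_nonneg _).trans hℓ)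
    (fun x => (norm_toEuclideanLin_le _ x).trans (mul_le_mul_of_nonneg_right hℓ (norm_nonneg x)))
    (fun x => (norm_toEuclideanLin_le _ x).trans (mul_le_mul_of_nonneg_right hℓ' (norm_nonneg x)))
    hsmall
  have h3 := (norm_toEuclideanLin_le (gaugeDefect φ (hamiltonian s G JXY JZ)) y).trans
    (mul_le_mul_of_nonneg_right hβ (norm_nonneg y))
  simpa only [gaugeDefect, map_sub, map_add, map_smul, LinearMap.sub_apply, LinearMap.add_apply,
    LinearMap.smul_apply, mul_assoc (gaugeOp s _), toEuclideanLin_mul_apply] using h3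

/-- A rotation that changes the Hamiltonian by little yields a bound on the transverse
correlations. -/
theorem norm_groundExpectation_le (φ : V → ℝ) {e w Δ β ℓ : ℝ} (hw0 : 0 ≤ w) (hΔ : 0 < Δ)
    (hgap : ∀ μ ∈ sectorSpectrum s G JXY JZ M \ E0, e + Δ < μ) (hw : ∀ μ ∈ E0, |μ - e| ≤ w)
    (hβ : ‖gaugeDefect φ (hamiltonian s G JXY JZ)‖ ≤ 2 * β) (hℓ : ‖gaugeOp s φ‖ ≤ ℓ)
    (hℓ' : ‖gaugeOp s (-φ)‖ ≤ ℓ) (hsmall : β + w * (1 + ℓ ^ 2) ≤ Δ / 4) (m n : V) :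
    ‖groundExpectation s G JXY JZ M E0 (site m (spinPlus s) * site n (spinMinus s))‖
      ≤ 2 * ‖raising s‖ ^ 2 * Real.exp (-(φ m - φ n)) := by
  rw [spinPlus_eq_raising, spinMinus_eq_lowering, groundExpectation]
  have hX : ∀ x : State V s,
      Matrix.toEuclideanLin (site m (raising s) * site n (raising s).conjTranspose) x
        = (Real.exp (-(φ m - φ n)) : ℂ) • Matrix.toEuclideanLin (gaugeOp s φ)
          (Matrix.toEuclideanLin (site m (raising s) * site n (raising s).conjTranspose)
            (Matrix.toEuclideanLin (gaugeOp s (-φ)) x)) := fun x => by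
    rw [← toEuclideanLin_mul_apply, ← toEuclideanLin_mul_apply, gaugeOp_conj_raising_lowering,
      map_smul, LinearMap.smul_apply, smul_smul, ← Complex.ofReal_mul, ← Real.exp_add,
      neg_add_cancel, Real.exp_zero, Complex.ofReal_one, one_smul]
  have hK : ‖site m (raising s) * site n (raising s).conjTranspose‖ ≤ ‖raising s‖ ^ 2 := by
    refine (norm_site_mul_site_le m n (raising s) (raising s).conjTranspose).trans_eq ?_
    rw [Matrix.l2_opNorm_conjTranspose, sq]
  have h1 := fun ψ (hψ : ψ ∈ groundSpace s G JXY JZ M E0) =>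
    norm_gaugeOp_sub_starProjection_le φ hw0 hΔ hgap hw hβ hℓ hℓ' hsmall hψ
  have hβ' : ‖gaugeDefect (-φ) (hamiltonian s G JXY JZ)‖ ≤ 2 * β := by
    simpa only [gaugeDefect_neg] using hβ
  have hℓ'' : ‖gaugeOp s (-(-φ))‖ ≤ ℓ := by simpa only [neg_neg] using hℓ
  have h2 := fun ψ (hψ : ψ ∈ groundSpace s G JXY JZ M E0) =>
    norm_gaugeOp_sub_starProjection_le (-φ) hw0 hΔ hgap hw hβ' hℓ' hℓ'' hsmall hψ
  have htr := norm_trace_comp_starProjection_le (W := groundSpace s G JXY JZ M E0)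
    (isSymmetric_gaugeOp φ) (gaugeOp_apply_gaugeOp_neg φ) (gaugeOp_neg_apply_gaugeOp φ) hX
    (fun x => (norm_toEuclideanLin_le _ x).trans (mul_le_mul_of_nonneg_right hK (norm_nonneg x)))
    h1 h2 (sq_nonneg _)
  rw [Complex.norm_real, Real.norm_of_nonneg (Real.exp_nonneg _)] at htr
  set q := Module.finrank ℂ (groundSpace s G JXY JZ M E0)
  -- For `q = 0` the left side is `0` by the convention for division.
  have hq : ‖1 / (q : ℂ)‖ * q ≤ 1 := by
    rw [norm_div, norm_one, Complex.norm_natCast, one_div_mul_eq_div]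
    exact div_self_le_one _
  rw [norm_mul]
  calc _ ≤ ‖1 / (q : ℂ)‖ * (Real.exp (-(φ m - φ n)) * (q * (2 * ‖raising s‖ ^ 2))) := by gcongr
    _ = (‖1 / (q : ℂ)‖ * q) * (2 * ‖raising s‖ ^ 2 * Real.exp (-(φ m - φ n))) := by ring
    _ ≤ 1 * (2 * ‖raising s‖ ^ 2 * Real.exp (-(φ m - φ n))) := by gcongr
    _ = _ := one_mul _

end Rotated

/-! ### The angles -/

section Angles

variable {V : Type*} {G : SimpleGraph V} {D C₀ : ℝ}

/-- The ball is its centre and `r` spheres, each bounded by the largest value `C₀ * r ^ (D - 1)`,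
since `D ≥ 1`. -/
theorem card_ball_le [Fintype V] [DecidableEq V] (hG : HasDimension G D C₀) (hC₀ : 0 ≤ C₀)
    (hD : 1 ≤ D) (m : V) (r : ℕ) :
    ((Finset.univ.filter fun l => G.dist m l ≤ r).card : ℝ) ≤ 1 + C₀ * (r : ℝ) ^ D := by
  have h1 : (Finset.univ.filter fun l => G.dist m l ≤ r) ⊆
      {m} ∪ (Finset.Icc 1 r).biUnion fun t => Finset.univ.filter fun l => G.dist l m = t := by
    intro l hl
    simp only [Finset.mem_filter, Finset.mem_univ, true_and] at hl
    simp only [Finset.mem_union, Finset.mem_singleton, Finset.mem_biUnion, Finset.mem_Icc,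
      Finset.mem_filter, Finset.mem_univ, true_and]
    rw [SimpleGraph.dist_comm] at hl
    rcases Nat.eq_zero_or_pos (G.dist l m) with h0 | h0
    · exact Or.inl (hG.connected.dist_eq_zero_iff.mp h0)
    · exact Or.inr ⟨_, ⟨h0, hl⟩, rfl⟩
  have h2 := (Finset.card_le_card h1).trans ((Finset.card_union_le _ _).trans
    (Nat.add_le_add_left Finset.card_biUnion_le _))
  have h3 : ∀ t ∈ Finset.Icc 1 r, ((Finset.univ.filter fun l => G.dist l m = t).card : ℝ)
      ≤ C₀ * (r : ℝ) ^ (D - 1) := fun t ht => by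
    rw [Finset.mem_Icc] at ht
    have := hG.card_sphere_le m t ht.1
    rw [Set.ncard_eq_toFinset_card', Set.toFinset_ofPred] at this
    refine this.trans ?_
    gcongr
    exact_mod_cast ht.2
  have h4 : ((Finset.univ.filter fun l => G.dist m l ≤ r).card : ℝ)
      ≤ 1 + ∑ t ∈ Finset.Icc 1 r, ((Finset.univ.filter fun l => G.dist l m = t).card : ℝ) := by
    rw [Finset.card_singleton] at h2
    exact_mod_cast h2
  refine h4.trans (add_le_add_right ?_ 1)
  refine (Finset.sum_le_card_nsmul _ _ _ h3).trans_eq ?_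
  rw [Nat.card_Icc, Nat.add_sub_cancel, nsmul_eq_mul]
  rcases Nat.eq_zero_or_pos r with h0 | h0
  · rw [h0, Nat.cast_zero, Real.zero_rpow (by linarith : D ≠ 0)]
    simp
  · have hr : (0 : ℝ) < r := by exact_mod_cast h0
    rw [Real.rpow_sub_one hr.ne']
    field_simp

/-- The neighbours of `m` form the sphere of radius `1`. -/
theorem degree_le [Fintype V] [DecidableRel G.Adj] (hG : HasDimension G D C₀) (m : V) :
    (G.degree m : ℝ) ≤ C₀ := by
  classical
  have h := hG.card_sphere_le m 1 le_rfl
  rw [Nat.cast_one, Real.one_rpow, mul_one, Set.ncard_eq_toFinset_card', Set.toFinset_ofPred] at h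
  convert h using 2
  rw [← SimpleGraph.card_neighborFinset_eq_degree]
  congr 1
  ext l
  simp [SimpleGraph.dist_eq_one_iff_adj, SimpleGraph.adj_comm]

/-- Angles that decrease linearly with the distance from `m`, with slope `g`, and that vanish at
distance `r` and beyond. -/
def coneAngle (G : SimpleGraph V) (g : ℝ) (r : ℕ) (m l : V) : ℝ := g * ((r - G.dist m l : ℕ) : ℝ)

theorem abs_coneAngle_le {g : ℝ} (hg : 0 ≤ g) (r : ℕ) (m l : V) :
    |coneAngle G g r m l| ≤ g * r := by
  rw [coneAngle, abs_of_nonneg (by positivity)]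
  gcongr
  exact Nat.sub_le _ _

theorem abs_coneAngle_sub_le {g : ℝ} (hg : 0 ≤ g) (r : ℕ) (m : V) {i j : V} (hij : G.Adj i j) :
    |coneAngle G g r m i - coneAngle G g r m j| ≤ g := by
  rw [coneAngle, coneAngle, ← mul_sub, abs_mul, abs_of_nonneg hg]
  refine mul_le_of_le_one_right hg ?_
  have h := hij.diff_dist_adj (u := m)
  have h1 : (r - G.dist m i : ℕ) ≤ (r - G.dist m j : ℕ) + 1 := by omega
  have h2 : (r - G.dist m j : ℕ) ≤ (r - G.dist m i : ℕ) + 1 := by omega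
  rw [abs_le]
  constructor
  · have : ((r - G.dist m j : ℕ) : ℝ) ≤ ((r - G.dist m i : ℕ) : ℝ) + 1 := by exact_mod_cast h2
    linarith
  · have : ((r - G.dist m i : ℕ) : ℝ) ≤ ((r - G.dist m j : ℕ) : ℝ) + 1 := by exact_mod_cast h1
    linarith

end Angles

/-! ### Decay on a single lattice -/

section Decay

open scoped Matrix.Norms.L2Operator

variable {V : Type*} [Fintype V] [DecidableEq V] {s : ℕ} {G : SimpleGraph V} {D C₀ : ℝ}

/-- Replacing `r` by `R` and the slope by `1` makes the bound uniform in the sites and the lattice.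
The hypothesis on absolute values covers the cone and its negative. -/
theorem norm_gaugeOp_le_of_le_dist (hG : HasDimension G D C₀) (hC₀ : 0 ≤ C₀) (hD : 1 ≤ D)
    {g : ℝ} (hg : g ≤ 1) {r R : ℕ} (hrR : r ≤ R) (m : V) (φ : V → ℝ)
    (hφ : ∀ l, |φ l| = |coneAngle G g r m l|) (hg0 : 0 ≤ g) :
    ‖gaugeOp s φ‖ ≤ Real.exp ((1 + C₀ * (R : ℝ) ^ D) * (R * s)) := by
  refine (norm_gaugeOp_le φ (Finset.univ.filter fun l => G.dist m l ≤ R) (a := R) (by positivity)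
    (fun i hi => ?_) fun i => ?_).trans ?_
  · simp only [Finset.mem_filter, Finset.mem_univ, true_and, not_le] at hi
    rw [← abs_eq_zero, hφ, coneAngle, Nat.sub_eq_zero_of_le (hrR.trans hi.le), Nat.cast_zero,
      mul_zero, abs_zero]
  · rw [hφ]
    refine (abs_coneAngle_le hg0 r m i).trans ?_
    have : (r : ℝ) ≤ R := by exact_mod_cast hrR
    nlinarith [(Nat.cast_nonneg r : (0 : ℝ) ≤ r)]
  · gcongr
    exact card_ball_le hG hC₀ hD m R

variable [DecidableRel G.Adj] {JXY JZ : Sym2 V → ℝ} {M : ℝ} {E0 : Set ℝ}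

/-- For a cone of radius `r` and height `δ * r ^ (1 - D / 2)`, the second-order change of the
Hamiltonian is bounded by a multiple of `δ ^ 2`. -/
theorem norm_gaugeDefect_coneAngle_le (hG : HasDimension G D C₀) (hC₀ : 0 ≤ C₀) (hD : 1 ≤ D)
    {J δ : ℝ} (hJ0 : 0 ≤ J) (hJ : ∀ e ∈ G.edgeSet, |JXY e| ≤ J) (hδ0 : 0 ≤ δ) (hδ : δ ≤ 1) (r : ℕ)
    (m : V) :
    ‖gaugeDefect (coneAngle G (δ * (r : ℝ) ^ (-(D / 2))) r m) (hamiltonian s G JXY JZ)‖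
      ≤ 2 * (2 * J * ‖raising s‖ ^ 2 * (C₀ * (1 + C₀)) * δ ^ 2) := by
  have hg0 : 0 ≤ δ * (r : ℝ) ^ (-(D / 2)) := by positivity
  have hr : r = 0 ∨ (1 : ℝ) ≤ r := by
    rcases Nat.eq_zero_or_pos r with h | h
    · exact Or.inl h
    · exact Or.inr (by exact_mod_cast h)
  have hg1 : δ * (r : ℝ) ^ (-(D / 2)) ≤ 1 := by
    rcases hr with rfl | hr
    · rw [Nat.cast_zero, Real.zero_rpow (by linarith), mul_zero]
      exact zero_le_one
    · exact mul_le_one₀ hδ (by positivity) (Real.rpow_le_one_of_one_le_of_nonpos hr (by linarith))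
  -- Here the exponent `D / 2` is decided: the squared slope `r ^ (-D)` compensates the volume `r ^
  -- D`. At `r = 0` the real power with nonzero exponent is `0`.
  have hcard : (1 + C₀ * (r : ℝ) ^ D) * ((r : ℝ) ^ (-(D / 2))) ^ 2 ≤ 1 + C₀ := by
    rcases hr with rfl | hr
    · rw [Nat.cast_zero, Real.zero_rpow (by linarith : -(D / 2) ≠ 0)]
      simp only [ne_eq, OfNat.ofNat_ne_zero, not_false_eq_true, zero_pow, mul_zero]
      positivity
    · have h1 : ((r : ℝ) ^ (-(D / 2))) ^ 2 = ((r : ℝ) ^ D)⁻¹ := by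
        rw [← Real.rpow_natCast, ← Real.rpow_mul (by positivity), ← Real.rpow_neg (by positivity)]
        congr 1
        push_cast
        ring
      have h2 : 1 ≤ (r : ℝ) ^ D := Real.one_le_rpow hr (by linarith)
      rw [h1, add_mul, mul_assoc, mul_inv_cancel₀ (by positivity), mul_one, one_mul]
      exact add_le_add_left (inv_le_one_of_one_le₀ h2) _
  refine (norm_gaugeDefect_hamiltonian_le _ G JXY JZ
    (Finset.univ.filter fun l => G.dist m l ≤ r) hJ (fun i hi => ?_)
    (fun i j => abs_coneAngle_sub_le hg0 r m) hg1 hJ0 (degree_le hG)).trans ?_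
  · simp only [Finset.mem_filter, Finset.mem_univ, true_and, not_le] at hi
    rw [coneAngle, Nat.sub_eq_zero_of_le hi.le, Nat.cast_zero, mul_zero]
  · calc _ ≤ (1 + C₀ * (r : ℝ) ^ D) * C₀ *
          (4 * J * ‖raising s‖ ^ 2 * (δ * (r : ℝ) ^ (-(D / 2))) ^ 2) := by
          gcongr
          exact card_ball_le hG hC₀ hD m r
      _ = 4 * J * ‖raising s‖ ^ 2 * C₀ * δ ^ 2 *
          ((1 + C₀ * (r : ℝ) ^ D) * ((r : ℝ) ^ (-(D / 2))) ^ 2) := by ring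
      _ ≤ 4 * J * ‖raising s‖ ^ 2 * C₀ * δ ^ 2 * (1 + C₀) := by gcongr
      _ = _ := by ring

/-- The decay of the transverse correlations at the distances at which the width `w` of the
ground-state sector is small enough. -/
theorem norm_groundExpectation_le_exp (hG : HasDimension G D C₀) (hC₀ : 0 ≤ C₀) (hD : 1 ≤ D)
    (hD2 : D < 2) {J δ e w Δ : ℝ} (hJ0 : 0 ≤ J) (hJ : ∀ e ∈ G.edgeSet, |JXY e| ≤ J) (hδ0 : 0 ≤ δ)
    (hδ : δ ≤ 1) (hw0 : 0 ≤ w) (hΔ : 0 < Δ)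
    (hgap : ∀ μ ∈ sectorSpectrum s G JXY JZ M \ E0, e + Δ < μ) (hw : ∀ μ ∈ E0, |μ - e| ≤ w)
    {R : ℕ} (hsmall : 2 * J * ‖raising s‖ ^ 2 * (C₀ * (1 + C₀)) * δ ^ 2
      + w * (1 + Real.exp ((1 + C₀ * (R : ℝ) ^ D) * (R * s)) ^ 2) ≤ Δ / 4)
    (m n : V) (hR : G.dist m n ≤ R) :
    ‖groundExpectation s G JXY JZ M E0 (site m (spinPlus s) * site n (spinMinus s))‖
      ≤ 2 * ‖raising s‖ ^ 2 * Real.exp (-δ * (G.dist m n : ℝ) ^ (1 - D / 2)) := by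
  set r := G.dist m n with hr
  set g := δ * (r : ℝ) ^ (-(D / 2)) with hg
  have hg0 : 0 ≤ g := by positivity
  have hg1 : g ≤ 1 := by
    rcases Nat.eq_zero_or_pos r with h | h
    · rw [hg, h, Nat.cast_zero, Real.zero_rpow (by linarith), mul_zero]
      exact zero_le_one
    · exact mul_le_one₀ hδ (by positivity)
        (Real.rpow_le_one_of_one_le_of_nonpos (by exact_mod_cast h) (by linarith))
  refine (norm_groundExpectation_le (coneAngle G g r m) hw0 hΔ hgap hw
    (norm_gaugeDefect_coneAngle_le hG hC₀ hD hJ0 hJ hδ0 hδ r m)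
    (norm_gaugeOp_le_of_le_dist hG hC₀ hD hg1 hR m _ (fun _ => rfl) hg0)
    (norm_gaugeOp_le_of_le_dist hG hC₀ hD hg1 hR m _ (fun _ => abs_neg _) hg0)
    hsmall m n).trans_eq ?_
  congr 2
  rw [coneAngle, coneAngle, SimpleGraph.dist_self, ← hr, Nat.sub_self, Nat.sub_zero, Nat.cast_zero,
    mul_zero, sub_zero, neg_mul, hg, mul_assoc]
  congr 2
  -- At `r = 0` both sides vanish, because `D < 2` keeps the exponent `1 - D / 2` nonzero.
  rcases Nat.eq_zero_or_pos r with h | h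
  · rw [h, Nat.cast_zero, mul_zero, Real.zero_rpow (by linarith)]
  · have h0 : (0 : ℝ) < r := by exact_mod_cast h
    rw [← Real.rpow_add_one h0.ne']
    congr 1
    ring

end Decay

end XXZ

end

/-! ### Choice of the constants and passage to large `k` -/

theorem theorem2 (s : ℕ) (hs : 1 ≤ s) (D : ℝ) (hD1 : 1 ≤ D) (hD2 : D < 2)
    (C₀ : ℝ) (hC₀ : 0 < C₀) (JmaxXY JmaxZ : ℝ) (hJXY : 0 < JmaxXY) (hJZ : 0 < JmaxZ)
    (ΔE : ℝ) (hΔE : 0 < ΔE) :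
    ∃ γ C : ℝ, 0 < γ ∧ 0 < C ∧
      ∀ (V : ℕ → Type*) [∀ k, Fintype (V k)] [∀ k, DecidableEq (V k)]
        (G : ∀ k, SimpleGraph (V k)) [∀ k, DecidableRel (G k).Adj]
        (JXY JZ : ∀ k, Sym2 (V k) → ℝ) (M : ℕ → ℝ) (E0 : ℕ → Set ℝ),
        Tendsto (fun k => Fintype.card (V k)) atTop atTop →
        (∀ k, XXZ.HasDimension (G k) D C₀) →
        (∀ k, ∀ e ∈ (G k).edgeSet, |JXY k e| ≤ JmaxXY) →
        (∀ k, ∀ e ∈ (G k).edgeSet, |JZ k e| ≤ JmaxZ) →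
        XXZ.HasUniformGap
          (fun k => XXZ.sectorSpectrum s (G k) (JXY k) (JZ k) (M k)) E0 ΔE →
        ∀ R : ℕ, ∀ᶠ k in atTop, ∀ m n : V k, (G k).dist m n ≤ R →
          ‖XXZ.groundExpectation s (G k) (JXY k) (JZ k) (M k) (E0 k)
              (XXZ.site m (XXZ.spinPlus s) * XXZ.site n (XXZ.spinMinus s))‖
            ≤ C * Real.exp (-γ * ((G k).dist m n : ℝ) ^ (1 - D / 2)) := by
  -- `ρ` is the `ℓ²` operator norm; its instance is scoped and hence named explicitly.
  obtain ⟨ρ, hρ⟩ : ∃ ρ : ℝ, ρ = Norm.norm (self := Matrix.instL2OpNormedAddCommGroup.toNorm)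
    (XXZ.raising s) := ⟨_, rfl⟩
  set κ : ℝ := 2 * JmaxXY * ρ ^ 2 * (C₀ * (1 + C₀)) with hκ
  have hκ0 : 0 ≤ κ := by positivity
  -- `κ * δ ^ 2` bounds the second-order change. Since `δ ≤ 1`, it is at most `κ * δ ≤ ΔE / 8`, half
  -- of the admissible `ΔE / 4`; the other half is left to the width.
  set δ : ℝ := min 1 (ΔE / (8 * (κ + 1))) with hδ
  have hδ0 : 0 < δ := lt_min one_pos (by positivity)
  have hδ1 : δ ≤ 1 := min_le_left _ _
  have hκδ : κ * δ ^ 2 ≤ ΔE / 8 := by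
    have h1 : δ * (8 * (κ + 1)) ≤ ΔE :=
      (le_div_iff₀ (by positivity)).mp (min_le_right 1 (ΔE / (8 * (κ + 1))))
    nlinarith [mul_nonneg hκ0 hδ0.le, mul_nonneg (mul_nonneg hκ0 hδ0.le) (sub_nonneg.mpr hδ1)]
  -- The summand `1` gives `0 < C` without a proof that `ρ ≠ 0`.
  refine ⟨δ, 2 * ρ ^ 2 + 1, hδ0, by positivity, ?_⟩
  intro V _ _ G _ JXY JZ M E0 _ hG hJ _ hgap R
  set A : ℝ := 1 + Real.exp ((1 + C₀ * (R : ℝ) ^ D) * (R * s)) ^ 2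
  have hlim : Tendsto (fun k => Metric.diam (E0 k) * A) atTop (𝓝 0) := by
    simpa using hgap.width.mul_const A
  filter_upwards [hlim.eventually_le_const (show 0 < ΔE / 8 by positivity)] with k hk m n hmn
  obtain ⟨e, he⟩ := hgap.nonempty k
  -- `Metric.diam` is `0` on unbounded sets, so the width controls `E0 k` only after boundedness is
  -- obtained from the finiteness of the spectrum.
  have hbdd : Bornology.IsBounded (E0 k) :=
    (XXZ.finite_sectorSpectrum.subset (hgap.subset k)).isBounded
  refine (XXZ.norm_groundExpectation_le_exp (hG k) hC₀.le hD1 hD2 hJXY.le (hJ k) hδ0.le hδ1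
    Metric.diam_nonneg hΔE (hgap.gap k e he)
    (fun μ hμ => Metric.dist_le_diam_of_mem hbdd hμ he) (R := R) ?_ m n hmn).trans ?_
  · rw [← hρ]
    linarith
  · rw [← hρ]
    gcongr
    linarith
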